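/- Let $M>0$ and $a\in\mathbb R$ with $a^2\le M^2$, and put $r_1=M+\sqrt{M^2-a^2}$, $$\Delta=r^2-2Mr+a^2,\qquad U=r^2+a^2\cos^2\vartheta,\qquad \sigma^2=(r^2+a^2)\,U+2Mr\,a^2\sin^2\vartheta .$$ In Boyer–Lindquist coordinates the Kerr metric is $$g_{\rm Kerr}=-\frac{\Delta}{U}\,(dt-a\sin^2\vartheta\,d\varphi)^2+U\Big(\frac{dr^2}{\Delta}+d\vartheta^2\Big)+\frac{\sin^2\vartheta}{U}\,\big(a\,dt-(r^2+a^2)\,d\varphi\big)^2 .$$ Let $\Sigma=(r_1,\infty)\times S^2$ be the slice $t=\mathrm{const}$ outside the event horizon (including the axis $\sin\vartheta=0$), realised through spherical polar coordinates $(r,\vartheta,\varphi)$ as $\{x\in\mathbb R^3:|x|>r_1\}$. Let $\mathbf g$ be the metric induced on $\Sigma$ by $g_{\rm Kerr}$, let $N=\sqrt{\Delta U/\sigma^2}$ be the lapse function, and let $$\tilde{\mathbf g}=N^{-2}\mathbf g,\qquad \hat{\mathbf g}=\frac{\sigma^2}{\Delta^2}\,dr^2+\frac{\sigma^2}{\Delta}\big(d\vartheta^2+\sin^2\vartheta\,d\varphi^2\big).$$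 Then $\tilde{\mathbf g}$ and $\hat{\mathbf g}$ are smooth Riemannian metrics on all of $\Sigma$ (the coordinate expressions extend smoothly across the axis), and the Riemannian manifold $(\Sigma,\tilde{\mathbf g})$ is geodesically complete: for every $p\in\Sigma$ and $v\in T_p\Sigma$ there is a geodesic $\gamma:\mathbb R\to\Sigma$ with $\gamma(0)=p$ and $\gamma'(0)=v$. Moreover, there is a constant $f\ge 1$ (depending only on $M$ and $a$) such that for all $r>r_1$ and all $\vartheta$ $$1\le\frac{\sigma^2}{U^2}\le f,$$ and $\hat{\mathbf g}(v,v)\le\tilde{\mathbf g}(v,v)\le f\,\hat{\mathbf g}(v,v)$ for all tangent vectors $v$ of $\Sigma$. -/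

import Mathlib

/-! ### Riemannian metrics and geodesics on an open subset of `ℝ³` -/

/-- `ℝ³` with the Euclidean inner product. -/
abbrev E3 : Type := EuclideanSpace ℝ (Fin 3)

/-- `G x u v` (the value at `x` on the tangent vectors `u, v`) is a smooth Riemannian metric on the
open set `S`. -/
structure IsRiemannianMetricOn (S : Set E3) (G : E3 → E3 → E3 → ℝ) : Prop where
  bilin : ∀ x ∈ S, ∃ B : LinearMap.BilinForm ℝ E3, ∀ u v, B u v = G x u v
  symm : ∀ x ∈ S, ∀ u v, G x u v = G x v u
  pos : ∀ x ∈ S, ∀ u, u ≠ 0 → 0 < G x u u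
  smooth : ∀ u v, ContDiffOn ℝ (⊤ : ℕ∞) (fun x => G x u v) S

/-- Christoffel symbols of the first kind in the Cartesian chart:
`Γ(u, v; w) = ½ (∂_u G(v, w) + ∂_v G(u, w) - ∂_w G(u, v))`. -/
noncomputable def christoffel (G : E3 → E3 → E3 → ℝ) (x u v w : E3) : ℝ :=
  (fderiv ℝ (fun y => G y v w) x u + fderiv ℝ (fun y => G y u w) x v
    - fderiv ℝ (fun y => G y u v) x w) / 2

/-- `γ : ℝ → S` is a geodesic of `G`, defined for all times: the covariant derivative of `γ'` along
`γ` vanishes, i.e. `G(γ'', w) + Γ(γ', γ'; w) = 0` for every vector `w`. -/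
structure IsGeodesicLine (S : Set E3) (G : E3 → E3 → E3 → ℝ) (γ : ℝ → E3) : Prop where
  contDiff : ContDiff ℝ 2 γ
  mem : ∀ t, γ t ∈ S
  eqn : ∀ t w, G (γ t) (deriv (deriv γ) t) w
    + christoffel G (γ t) (deriv γ t) (deriv γ t) w = 0

/-- Every initial point and initial velocity launch a geodesic that exists for all times in `ℝ`. -/
def GeodesicallyComplete (S : Set E3) (G : E3 → E3 → E3 → ℝ) : Prop :=
  ∀ p ∈ S, ∀ v : E3, ∃ γ : ℝ → E3, IsGeodesicLine S G γ ∧ γ 0 = p ∧ deriv γ 0 = v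

namespace Kerr

/-! ### The Kerr metric in Boyer-Lindquist coordinates -/

/-- `Δ = r² - 2Mr + a²` -/
noncomputable def Delta (M a r : ℝ) : ℝ := r ^ 2 - 2 * M * r + a ^ 2

/-- `U = r² + a² cos² ϑ` -/
noncomputable def U (a r ϑ : ℝ) : ℝ := r ^ 2 + a ^ 2 * Real.cos ϑ ^ 2

/-- `σ² = (r² + a²) U + 2 M r a² sin² ϑ` -/
noncomputable def sigmaSq (M a r ϑ : ℝ) : ℝ :=
  (r ^ 2 + a ^ 2) * U a r ϑ + 2 * M * r * a ^ 2 * Real.sin ϑ ^ 2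

/-- The radius of the outer event horizon. -/
noncomputable def r₁ (M a : ℝ) : ℝ := M + Real.sqrt (M ^ 2 - a ^ 2)

/-- The Kerr spacetime metric; vectors are listed as `(dt, dr, dϑ, dφ)`. -/
noncomputable def spacetimeMetric (M a r ϑ : ℝ) (v w : Fin 4 → ℝ) : ℝ :=
  -(Delta M a r / U a r ϑ) * (v 0 - a * Real.sin ϑ ^ 2 * v 3) * (w 0 - a * Real.sin ϑ ^ 2 * w 3)
    + U a r ϑ * (v 1 * w 1 / Delta M a r + v 2 * w 2)
    + Real.sin ϑ ^ 2 / U a r ϑ * (a * v 0 - (r ^ 2 + a ^ 2) * v 3)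
      * (a * w 0 - (r ^ 2 + a ^ 2) * w 3)

/-- The metric `g` induced on the slices `t = const`; vectors are listed as `(dr, dϑ, dφ)`. -/
noncomputable def spatialMetricBL (M a r ϑ : ℝ) (v w : Fin 3 → ℝ) : ℝ :=
  spacetimeMetric M a r ϑ ![0, v 0, v 1, v 2] ![0, w 0, w 1, w 2]

/-- The lapse function, `N² = Δ U / σ²`. -/
noncomputable def lapse (M a r ϑ : ℝ) : ℝ :=
  Real.sqrt (Delta M a r * U a r ϑ / sigmaSq M a r ϑ)

/-- The metric `g̃ = N⁻² g`. -/
noncomputable def tildeMetricBL (M a r ϑ : ℝ) (v w : Fin 3 → ℝ) : ℝ :=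
  (lapse M a r ϑ ^ 2)⁻¹ * spatialMetricBL M a r ϑ v w

/-- The metric `ĝ = σ²/Δ² dr² + σ²/Δ (dϑ² + sin² ϑ dφ²)`. -/
noncomputable def hatMetricBL (M a r ϑ : ℝ) (v w : Fin 3 → ℝ) : ℝ :=
  sigmaSq M a r ϑ / Delta M a r ^ 2 * (v 0 * w 0)
    + sigmaSq M a r ϑ / Delta M a r * (v 1 * w 1 + Real.sin ϑ ^ 2 * (v 2 * w 2))

theorem Delta_pos {M a r : ℝ} (ha : a ^ 2 ≤ M ^ 2) (hr : r₁ M a < r) : 0 < Delta M a r := by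
  have h1 : Real.sqrt (M ^ 2 - a ^ 2) < r - M := by unfold r₁ at hr; linarith
  have h2 := Real.sqrt_nonneg (M ^ 2 - a ^ 2)
  have h3 := Real.sq_sqrt (sub_nonneg.2 ha)
  unfold Delta
  nlinarith

/-- `N` is indeed the lapse of the slices `t = const`: with the shift vector
`(0, 0, -2 M a r / σ²)` one has `g_Kerr = -N² dt² + g_ij (dx^i + N^i dt) (dx^j + N^j dt)`. -/
theorem spacetimeMetric_eq {M a r : ℝ} (ϑ : ℝ) (hM : 0 < M) (ha : a ^ 2 ≤ M ^ 2)
    (hr : r₁ M a < r) (v w : Fin 4 → ℝ) :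
    spacetimeMetric M a r ϑ v w = -(lapse M a r ϑ ^ 2) * (v 0 * w 0)
      + spatialMetricBL M a r ϑ ![v 1, v 2, v 3 + -(2 * M * a * r / sigmaSq M a r ϑ) * v 0]
          ![w 1, w 2, w 3 + -(2 * M * a * r / sigmaSq M a r ϑ) * w 0] := by
  have hr0 : 0 < r := by
    have := Real.sqrt_nonneg (M ^ 2 - a ^ 2)
    unfold r₁ at hr
    linarith
  have hD := Delta_pos ha hr
  have hU : 0 < U a r ϑ := by unfold U; positivity
  have hs : 0 < sigmaSq M a r ϑ := by unfold sigmaSq; positivity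
  rw [lapse, Real.sq_sqrt (by positivity)]
  simp only [spatialMetricBL, spacetimeMetric, Matrix.cons_val]
  have hU' := hU.ne'
  have hs' := hs.ne'
  have hD' := hD.ne'
  have e1 : U a r ϑ = r ^ 2 + a ^ 2 * (1 - Real.sin ϑ ^ 2) := by
    rw [U, Real.cos_sq']
  have e2 : sigmaSq M a r ϑ = (r ^ 2 + a ^ 2) * (r ^ 2 + a ^ 2 * (1 - Real.sin ϑ ^ 2))
      + 2 * M * r * a ^ 2 * Real.sin ϑ ^ 2 := by rw [sigmaSq, e1]
  field_simp
  rw [e2, e1, Delta]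
  ring

/-! ### The slice as a manifold

The slice is `(r₁, ∞) × S²`, realised through spherical polar coordinates as the set of `x ∈ ℝ³` with
`r = ‖x‖ > r₁`, so that the axis `sin ϑ = 0` is part of it. -/

/-- The slice `Σ` outside the event horizon. -/
def slice (M a : ℝ) : Set E3 := {x | r₁ M a < ‖x‖}

/-- The polar angle of a point. -/
noncomputable def polarAngle (x : E3) : ℝ := Real.arccos (x 2 / ‖x‖)

/-- The one-form `dr`. -/
noncomputable def dr (x v : E3) : ℝ := inner ℝ x v / ‖x‖

/-- The round metric `dϑ² + sin² ϑ dφ²`. -/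
noncomputable def roundMetric (x v w : E3) : ℝ := (inner ℝ v w - dr x v * dr x w) / ‖x‖ ^ 2

/-- The one-form `sin² ϑ dφ`. -/
noncomputable def axialForm (x v : E3) : ℝ := (x 0 * v 1 - x 1 * v 0) / ‖x‖ ^ 2

/-- The induced metric `g` on the slice, in a form that is regular on the axis:
`g = U/Δ dr² + U (dϑ² + sin² ϑ dφ²) + a² (1 + 2Mr/U) (sin² ϑ dφ)²`. -/
noncomputable def spatialMetric (M a : ℝ) (x v w : E3) : ℝ :=
  U a ‖x‖ (polarAngle x) / Delta M a ‖x‖ * (dr x v * dr x w)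
    + U a ‖x‖ (polarAngle x) * roundMetric x v w
    + a ^ 2 * (1 + 2 * M * ‖x‖ / U a ‖x‖ (polarAngle x)) * (axialForm x v * axialForm x w)

/-- The metric `g̃ = N⁻² g` on the slice. -/
noncomputable def tildeMetric (M a : ℝ) (x v w : E3) : ℝ :=
  (lapse M a ‖x‖ (polarAngle x) ^ 2)⁻¹ * spatialMetric M a x v w

/-- The metric `ĝ = σ²/Δ² dr² + σ²/Δ (dϑ² + sin² ϑ dφ²)` on the slice. -/
noncomputable def hatMetric (M a : ℝ) (x v w : E3) : ℝ :=
  sigmaSq M a ‖x‖ (polarAngle x) / Delta M a ‖x‖ ^ 2 * (dr x v * dr x w)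
    + sigmaSq M a ‖x‖ (polarAngle x) / Delta M a ‖x‖ * roundMetric x v w

/-- Spherical polar coordinates `(r, ϑ, φ) ↦ x`. -/
noncomputable def polarMap (q : Fin 3 → ℝ) : E3 :=
  !₂[q 0 * Real.sin (q 1) * Real.cos (q 2), q 0 * Real.sin (q 1) * Real.sin (q 2),
    q 0 * Real.cos (q 1)]

/-- In the coordinates `(r, ϑ, φ)`, `r > r₁`, `0 ≤ ϑ ≤ π`, the metric `G` on the slice takes
the form `b r ϑ` (pullback along `polarMap`). -/
def HasBLForm (M a : ℝ) (G : E3 → E3 → E3 → ℝ)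
    (b : ℝ → ℝ → (Fin 3 → ℝ) → (Fin 3 → ℝ) → ℝ) : Prop :=
  ∀ q : Fin 3 → ℝ, r₁ M a < q 0 → q 1 ∈ Set.Icc 0 Real.pi → ∀ v w : Fin 3 → ℝ,
    G (polarMap q) (fderiv ℝ polarMap q v) (fderiv ℝ polarMap q w) = b (q 0) (q 1) v w

end Kerr

open Set Filter Topology

/-! ### Global solutions of autonomous differential equations -/

/-! Multiplying the induced metric by N⁻² = σ²/(ΔU) turns its dr² and round parts into exactly those
of ĝ, so g̃ is ĝ plus a nonnegative multiple of (sin²ϑ dφ)² (`tildeMetric_eq`). This gives ĝ ≤ g̃.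
Since (sin²ϑ dφ)² ≤ sin²ϑ (dϑ² + sin²ϑ dφ²) and M < r, the extra term is at most 3ĝ
(`sin_sq_mul_div_le`, `axialForm_sq_le`); the same estimate bounds σ²/U², so f = 4 serves both
claims. Smoothness on the axis holds because the coefficients depend only on ‖x‖ and x₂/‖x‖, and the
forms involved are smooth in Cartesian coordinates.

Completeness follows from Gordon's criterion (`IsRiemannianMetricOn.geodesicallyComplete`) with h =
log(r - r₁). This h is proper, tending to -∞ at the horizon and to +∞ at infinity. Its gradient is
bounded because Δ ≤ r(r - r₁) and r⁴ ≤ σ² make the dr² coefficient σ²/Δ² at least M²/(r - r₁)²; the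
bound covers |a| = M as well.

The criterion rests on conservation of energy: along a geodesic h then grows at most linearly and,
on the compact region so obtained, the energy also bounds the Euclidean speed. Position and velocity
thus stay in a compact set for bounded times. To use this bound before the geodesic is known to
exist, the spray is multiplied by a cut-off; the bounds survive the rescaling by a factor in [0, 1],
so the cut-off equals 1 along the curve. -/

/-- A bounded Lipschitz vector field has integral curves on arbitrarily long time intervals. -/
theorem LipschitzWith.exists_hasDerivAt_Ioo {E : Type*} [NormedAddCommGroup E] [NormedSpace ℝ E]
    [CompleteSpace E] {W : E → E} {K : NNReal} (hK : LipschitzWith K W) {L : ℝ}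
    (hL : ∀ x, ‖W x‖ ≤ L) (p : E) {T : ℝ} (hT : 0 < T) :
    ∃ γ : ℝ → E, γ 0 = p ∧ ∀ t ∈ Ioo (-T) T, HasDerivAt γ (W (γ t)) t := by
  have hL0 : 0 ≤ L := (norm_nonneg _).trans (hL p)
  -- A ball of radius L·T cannot be left within time T at speed at most L.
  have hP : IsPicardLindelof (fun _ => W) (⟨0, by constructor <;> linarith⟩ : Icc (-T) T) p
      (L.toNNReal * T.toNNReal) 0 L.toNNReal K := by
    refine .of_time_independent (fun x _ => ?_) (hK.lipschitzOnWith) ?_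
    · rw [Real.coe_toNNReal _ hL0]
      exact hL x
    · simp [Real.coe_toNNReal _ hL0, Real.coe_toNNReal _ hT.le]
  obtain ⟨γ, h0, h⟩ := hP.exists_eq_forall_mem_Icc_hasDerivWithinAt₀
  exact ⟨γ, h0, fun t ht =>
    (h t (Ioo_subset_Icc_self ht)).hasDerivAt (Icc_mem_nhds ht.1 ht.2)⟩

/-- Curves on the intervals `(-(n + 1), n + 1)` that agree where they are both defined and solve an
equation glue to a global solution. -/
theorem exists_hasDerivAt_of_eqOn_Ioo {E : Type*} [NormedAddCommGroup E] [NormedSpace ℝ E]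
    {F : E → E} {γ : ℕ → ℝ → E}
    (hγ : ∀ n : ℕ, ∀ t ∈ Ioo (-(n + 1 : ℝ)) (n + 1), HasDerivAt (γ n) (F (γ n t)) t)
    (heq : ∀ m n : ℕ, m ≤ n → EqOn (γ m) (γ n) (Ioo (-(m + 1 : ℝ)) (m + 1))) :
    ∃ Γ : ℝ → E, (∀ n : ℕ, EqOn Γ (γ n) (Ioo (-(n + 1 : ℝ)) (n + 1))) ∧
      ∀ t, HasDerivAt Γ (F (Γ t)) t := by
  have hmem : ∀ t : ℝ, t ∈ Ioo (-((⌈|t|⌉₊ : ℕ) + 1 : ℝ)) ((⌈|t|⌉₊ : ℕ) + 1) := fun t => by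
    rw [mem_Ioo, ← abs_lt]
    exact (Nat.le_ceil _).trans_lt (lt_add_one _)
  have hΓ : ∀ n : ℕ, EqOn (fun t => γ ⌈|t|⌉₊ t) (γ n) (Ioo (-(n + 1 : ℝ)) (n + 1)) := by
    intro n t ht
    rcases le_total n ⌈|t|⌉₊ with h | h
    · exact (heq _ _ h ht).symm
    · exact heq _ _ h (hmem t)
  refine ⟨fun t => γ ⌈|t|⌉₊ t, hΓ, fun t => ?_⟩
  exact (hγ _ t (hmem t)).congr_of_eventuallyEq
    ((hΓ _).eventuallyEq_of_mem (Ioo_mem_nhds (hmem t).1 (hmem t).2))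

theorem ContDiffOn.exists_lipschitzOnWith_of_isCompact {E F : Type*} [NormedAddCommGroup E]
    [NormedSpace ℝ E] [NormedAddCommGroup F] [NormedSpace ℝ F] {Ω K : Set E} (hΩ : IsOpen Ω)
    {f : E → F} (hf : ContDiffOn ℝ 1 f Ω) (hK : IsCompact K) (hKΩ : K ⊆ Ω) :
    ∃ C, LipschitzOnWith C f K := by
  refine LocallyLipschitzOn.exists_lipschitzOnWith_of_compact hK fun x hx => ?_
  obtain ⟨C, t, ht, h⟩ := (hf.contDiffAt (hΩ.mem_nhds (hKΩ hx))).exists_lipschitzOnWith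
  exact ⟨C, t, mem_nhdsWithin_of_mem_nhds ht, h⟩

/-- A cut-off function on an open subset of a finite dimensional space. -/
theorem IsCompact.exists_contDiff_cutoff {E : Type*} [NormedAddCommGroup E] [NormedSpace ℝ E]
    [FiniteDimensional ℝ E] {Ω K : Set E} (hΩ : IsOpen Ω) (hK : IsCompact K) (hKΩ : K ⊆ Ω) :
    ∃ χ : E → ℝ, ContDiff ℝ 1 χ ∧ HasCompactSupport χ ∧ tsupport χ ⊆ Ω ∧
      (∀ x ∈ K, χ x = 1) ∧ ∀ x, χ x ∈ Icc (0 : ℝ) 1 := by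
  obtain ⟨L, hL, hKL, hLΩ⟩ := exists_compact_between hK hΩ hKΩ
  obtain ⟨χ, h1, h0, h⟩ := exists_contMDiffMap_one_nhds_of_subset_interior
    (modelWithCornersSelf ℝ E) (n := 1) hK.isClosed hKL
  have hs : tsupport χ ⊆ L :=
    closure_minimal (fun x hx => by_contra fun hxL => hx (h0 x hxL)) hL.isClosed
  exact ⟨χ, χ.contMDiff.contDiff, hL.of_isClosed_subset (isClosed_tsupport _) hs,
    hs.trans hLΩ, fun x hx => h1.self_of_nhdsSet x hx, h⟩

/-- If `χ` is a cut-off function supported in `Ω`, then the integral curve of `χ • F` through a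
point of `Ω` exists for a long time and stays in `Ω`. -/
theorem exists_hasDerivAt_smul_Ioo {E : Type*} [NormedAddCommGroup E] [NormedSpace ℝ E]
    [CompleteSpace E] {Ω : Set E} (hΩ : IsOpen Ω) {F : E → E} (hF : ContDiffOn ℝ 1 F Ω)
    {χ : E → ℝ} (hχ : ContDiff ℝ 1 χ) (hχc : HasCompactSupport χ) (hχΩ : tsupport χ ⊆ Ω)
    {p : E} (hp : p ∈ Ω) {T : ℝ} (hT : 0 < T) :
    ∃ γ : ℝ → E, γ 0 = p ∧
      ∀ t ∈ Ioo (-T) T, γ t ∈ Ω ∧ HasDerivAt γ (χ (γ t) • F (γ t)) t := by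
  have hW : ContDiff ℝ 1 (fun x => χ x • F x) := by
    rw [contDiff_iff_contDiffAt]
    intro x
    by_cases hx : x ∈ Ω
    · exact hχ.contDiffAt.smul (hF.contDiffAt (hΩ.mem_nhds hx))
    · have h : (fun x => χ x • F x) =ᶠ[𝓝 x] fun _ => 0 := by
        filter_upwards [(notMem_tsupport_iff_eventuallyEq (f := χ)).1 fun h => hx (hχΩ h)] with y hy
        simp [hy]
      exact contDiffAt_const.congr_of_eventuallyEq h
  have hWc : HasCompactSupport (fun x => χ x • F x) := hχc.smul_right
  obtain ⟨K, hK⟩ := hW.lipschitzWith_of_hasCompactSupport hWc one_ne_zero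
  obtain ⟨L, hL⟩ := hWc.exists_bound_of_continuous hW.continuous
  obtain ⟨γ, h0, h⟩ := hK.exists_hasDerivAt_Ioo hL p hT
  refine ⟨γ, h0, fun t ht => ⟨?_, h t ht⟩⟩
  by_contra hx
  -- Outside Ω the field vanishes, so the constant curve at γ t is also an integral curve; by
  -- uniqueness γ is constant, which contradicts γ 0 = p ∈ Ω.
  have hz : χ (γ t) • F (γ t) = 0 := by
    rw [image_eq_zero_of_notMem_tsupport fun h => hx (hχΩ h), zero_smul]
  have huniq : EqOn γ (fun _ => γ t) (Ioo (-T) T) :=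
    ODE_solution_unique_of_mem_Ioo (v := fun _ x => χ x • F x) (s := fun _ => univ)
      (fun _ _ => hK.lipschitzOnWith) ht
      (fun s hs => ⟨h s hs, mem_univ _⟩)
      (fun s _ => ⟨by simpa only [hz] using hasDerivAt_const s (γ t), mem_univ _⟩) rfl
  have h00 := huniq (x := 0) ⟨by linarith, hT⟩
  exact hx (by simpa [← h00, h0] using hp)

/-- If the solutions of `γ' = c F(γ)` with `0 ≤ c ≤ 1` that start at `p ∈ Ω` stay in compact
subsets of `Ω` for bounded times, then the solution of `γ' = F(γ)` starting at `p` exists for all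
times. -/
theorem exists_hasDerivAt_of_forall_mem_compact {E : Type*} [NormedAddCommGroup E]
    [NormedSpace ℝ E] [FiniteDimensional ℝ E] {Ω : Set E} (hΩ : IsOpen Ω) {F : E → E}
    (hF : ContDiffOn ℝ 1 F Ω) {p : E} (hp : p ∈ Ω)
    (hcpt : ∀ T : ℝ, 0 < T → ∃ K : Set E, IsCompact K ∧ K ⊆ Ω ∧
      ∀ (γ : ℝ → E) (c : ℝ → ℝ), γ 0 = p → (∀ t, c t ∈ Icc (0 : ℝ) 1) →
        (∀ t ∈ Ioo (-T) T, γ t ∈ Ω ∧ HasDerivAt γ (c t • F (γ t)) t) →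
        ∀ t ∈ Ioo (-T) T, γ t ∈ K) :
    ∃ γ : ℝ → E, γ 0 = p ∧ ∀ t, γ t ∈ Ω ∧ HasDerivAt γ (F (γ t)) t := by
  have : CompleteSpace E := FiniteDimensional.complete ℝ E
  have key : ∀ n : ℕ, ∃ (K : Set E) (γ : ℝ → E), IsCompact K ∧ K ⊆ Ω ∧ γ 0 = p ∧
      ∀ t ∈ Ioo (-(n + 1 : ℝ)) (n + 1), HasDerivAt γ (F (γ t)) t ∧ γ t ∈ K := by
    intro n
    have hn : (0 : ℝ) < n + 1 := by positivity
    obtain ⟨K, hK, hKΩ, h⟩ := hcpt _ hn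
    obtain ⟨χ, hχ, hχc, hχΩ, hχ1, hχI⟩ := hK.exists_contDiff_cutoff hΩ hKΩ
    obtain ⟨γ, h0, hγ⟩ := exists_hasDerivAt_smul_Ioo hΩ hF hχ hχc hχΩ hp hn
    -- The cut-off along the curve plays the role of the factor c. Since the curve stays in K, where
    -- χ = 1, it solves the original equation.
    have hmem := h γ (fun t => χ (γ t)) h0 (fun t => hχI _) hγ
    refine ⟨K, γ, hK, hKΩ, h0, fun t ht => ⟨?_, hmem t ht⟩⟩
    simpa [hχ1 _ (hmem t ht)] using (hγ t ht).2
  choose K γ hK hKΩ h0 hγ using key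
  obtain ⟨Γ, hΓ, hΓ'⟩ := exists_hasDerivAt_of_eqOn_Ioo (F := F) (γ := γ)
    (fun n t ht => (hγ n t ht).1) (fun m n hmn => by
      -- F need not be Lipschitz on Ω, but it is on the union of the two compact sets holding the
      -- curves, and uniqueness needs no more.
      obtain ⟨C, hC⟩ := hF.exists_lipschitzOnWith_of_isCompact hΩ ((hK m).union (hK n))
        (union_subset (hKΩ m) (hKΩ n))
      have hmn' : (m : ℝ) ≤ n := by exact_mod_cast hmn
      refine ODE_solution_unique_of_mem_Ioo (v := fun _ => F) (s := fun _ => K m ∪ K n) (t₀ := 0)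
        (fun _ _ => hC) ⟨by linarith [m.cast_nonneg (α := ℝ)], by positivity⟩
        (fun t ht => ⟨(hγ m t ht).1, .inl (hγ m t ht).2⟩) (fun t ht => ?_) (by rw [h0, h0])
      have ht' : t ∈ Ioo (-(n + 1 : ℝ)) (n + 1) := ⟨by linarith [ht.1], by linarith [ht.2]⟩
      exact ⟨(hγ n t ht').1, .inr (hγ n t ht').2⟩)
  refine ⟨Γ, ?_, fun t => ⟨?_, hΓ' t⟩⟩
  · rw [hΓ 0 (by simp), h0]
  · have ht : t ∈ Ioo (-((⌈|t|⌉₊ : ℕ) + 1 : ℝ)) ((⌈|t|⌉₊ : ℕ) + 1) := by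
      rw [mem_Ioo, ← abs_lt]
      exact (Nat.le_ceil _).trans_lt (lt_add_one _)
    rw [hΓ _ ht]
    exact hKΩ _ (hγ _ t ht).2

/-! ### The geodesic spray -/

namespace IsRiemannianMetricOn

variable {S : Set E3} {G : E3 → E3 → E3 → ℝ}

/-- Smoothness of a metric is only assumed for fixed vectors. Components in the standard basis
separate the dependence on the point from the polynomial dependence on the vectors, so that both can
vary together. -/
theorem eq_sum (hG : IsRiemannianMetricOn S G) {x : E3} (hx : x ∈ S) (u v : E3) :
    G x u v = ∑ i, ∑ j, u i * v j *
      G x (EuclideanSpace.basisFun _ ℝ i) (EuclideanSpace.basisFun _ ℝ j) := by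
  obtain ⟨B, hB⟩ := hG.bilin x hx
  have hs := fun w : E3 => (EuclideanSpace.basisFun (Fin 3) ℝ).sum_repr w
  conv_lhs => rw [← hB, ← hs u, ← hs v]
  simp only [map_sum, map_smul, LinearMap.sum_apply, LinearMap.smul_apply, smul_eq_mul, hB,
    EuclideanSpace.basisFun_repr]
  simp only [Finset.mul_sum, mul_assoc]
  rw [Finset.sum_comm]
  exact Finset.sum_congr rfl fun i _ => Finset.sum_congr rfl fun j _ => by ring

theorem differentiableAt (hG : IsRiemannianMetricOn S G) (hS : IsOpen S) {x : E3} (hx : x ∈ S)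
    (u v : E3) : DifferentiableAt ℝ (fun y => G y u v) x :=
  ((hG.smooth u v).contDiffAt (hS.mem_nhds hx)).differentiableAt (by simp)

theorem fderiv_eq_sum (hG : IsRiemannianMetricOn S G) (hS : IsOpen S) {x : E3} (hx : x ∈ S)
    (u v w : E3) : fderiv ℝ (fun y => G y u v) x w = ∑ i, ∑ j, u i * v j *
      fderiv ℝ (fun y => G y (EuclideanSpace.basisFun _ ℝ i) (EuclideanSpace.basisFun _ ℝ j))
        x w := by
  have h : (fun y => G y u v) =ᶠ[𝓝 x] fun y => ∑ i, ∑ j, u i * v j *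
      G y (EuclideanSpace.basisFun _ ℝ i) (EuclideanSpace.basisFun _ ℝ j) := by
    filter_upwards [hS.mem_nhds hx] with y hy using hG.eq_sum hy u v
  rw [h.fderiv_eq]
  have hd := fun i j => (hG.differentiableAt hS hx (EuclideanSpace.basisFun _ ℝ i)
    (EuclideanSpace.basisFun _ ℝ j)).hasFDerivAt.const_mul (u i * v j)
  have := HasFDerivAt.fun_sum fun i (_ : i ∈ Finset.univ) =>
    HasFDerivAt.fun_sum fun j (_ : j ∈ Finset.univ) => hd i j
  rw [this.fderiv]
  simp

/-- Linearity in the last slot is what allows Γ(v, v; ·) to be represented by a vector, and hence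
the geodesic equation to be solved for the acceleration. -/
theorem christoffel_self_eq_sum (hG : IsRiemannianMetricOn S G) (hS : IsOpen S) {x : E3}
    (hx : x ∈ S) (v w : E3) : christoffel G x v v w =
      ∑ k, w k * christoffel G x v v (EuclideanSpace.basisFun _ ℝ k) := by
  have h1 : fderiv ℝ (fun y => G y v w) x v =
      ∑ k, w k * fderiv ℝ (fun y => G y v (EuclideanSpace.basisFun _ ℝ k)) x v := by
    simp only [hG.fderiv_eq_sum hS hx v]
    simp only [Finset.mul_sum]
    rw [Finset.sum_comm]
    refine Finset.sum_congr rfl fun k _ => Finset.sum_congr rfl fun i _ => ?_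
    rw [Finset.sum_eq_single k]
    · simp
      ring
    · intro j _ hjk
      simp [hjk]
    · simp
  have h2 : fderiv ℝ (fun y => G y v v) x w =
      ∑ k, w k * fderiv ℝ (fun y => G y v v) x (EuclideanSpace.basisFun _ ℝ k) := by
    conv_lhs => rw [← (EuclideanSpace.basisFun (Fin 3) ℝ).sum_repr w]
    simp only [map_sum, map_smul, smul_eq_mul, EuclideanSpace.basisFun_repr]
  simp only [christoffel]
  rw [h1, h2, ← Finset.sum_add_distrib, ← Finset.sum_sub_distrib, Finset.sum_div]
  exact Finset.sum_congr rfl fun k _ => by ring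

/-- These are the two kinds of derivative in Γ(v, v; w). Both are polynomial in v, which makes the
spray C¹ jointly in position and velocity. -/
theorem contDiffOn_fderiv (hG : IsRiemannianMetricOn S G) (hS : IsOpen S) (w : E3) :
    ContDiffOn ℝ 1 (fun q : E3 × E3 => fderiv ℝ (fun y => G y q.2 w) q.1 q.2) (S ×ˢ univ) ∧
      ContDiffOn ℝ 1 (fun q : E3 × E3 => fderiv ℝ (fun y => G y q.2 q.2) q.1 w) (S ×ˢ univ) := by
  have hD : ∀ i j, ContDiffOn ℝ 1 (fun q : E3 × E3 => fderiv ℝ (fun y =>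
      G y (EuclideanSpace.basisFun _ ℝ i) (EuclideanSpace.basisFun _ ℝ j)) q.1) (S ×ˢ univ) :=
    fun i j => ((hG.smooth _ _).fderiv_of_isOpen hS (m := 1) (by exact WithTop.coe_le_coe.2 le_top)).comp
      contDiff_fst.contDiffOn fun q hq => hq.1
  have hc : ∀ i, ContDiff ℝ 1 (fun q : E3 × E3 => q.2 i) := fun i => by fun_prop
  constructor
  · refine ContDiffOn.congr (f := fun q : E3 × E3 => ∑ i, ∑ j, q.2 i * w j * fderiv ℝ (fun y =>
      G y (EuclideanSpace.basisFun _ ℝ i) (EuclideanSpace.basisFun _ ℝ j)) q.1 q.2) ?_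
      fun q hq => hG.fderiv_eq_sum hS hq.1 _ _ _
    exact ContDiffOn.sum fun i _ => ContDiffOn.sum fun j _ =>
      ((hc i).contDiffOn.mul contDiffOn_const).mul ((hD i j).clm_apply contDiff_snd.contDiffOn)
  · refine ContDiffOn.congr (f := fun q : E3 × E3 => ∑ i, ∑ j, q.2 i * q.2 j * fderiv ℝ (fun y =>
      G y (EuclideanSpace.basisFun _ ℝ i) (EuclideanSpace.basisFun _ ℝ j)) q.1 w) ?_
      fun q hq => hG.fderiv_eq_sum hS hq.1 _ _ _
    exact ContDiffOn.sum fun i _ => ContDiffOn.sum fun j _ =>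
      ((hc i).contDiffOn.mul (hc j).contDiffOn).mul ((hD i j).clm_apply contDiffOn_const)

/-- The metric as a field of operators with respect to the Euclidean inner product. -/
theorem exists_operator (hG : IsRiemannianMetricOn S G) :
    ∃ B : E3 → E3 →L[ℝ] E3, ContDiffOn ℝ 1 B S ∧ (∀ x ∈ S, IsUnit (B x)) ∧
      ∀ x ∈ S, ∀ u v, inner ℝ (B x u) v = G x u v := by
  let e := EuclideanSpace.basisFun (Fin 3) ℝ
  let B : E3 → E3 →L[ℝ] E3 := fun x =>
    ∑ i, ∑ j, G x (e i) (e j) • (innerSL ℝ (e i)).smulRight (e j)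
  have hB : ∀ x ∈ S, ∀ u v, inner ℝ (B x u) v = G x u v := by
    intro x hx u v
    rw [hG.eq_sum hx u v]
    simp only [B, _root_.sum_apply, sum_inner]
    refine Finset.sum_congr rfl fun i _ => Finset.sum_congr rfl fun j _ => ?_
    simp [e, inner_smul_left, EuclideanSpace.inner_single_left]
    ring
  refine ⟨B, ?_, fun x hx => ?_, hB⟩
  · exact ContDiffOn.sum fun i _ => ContDiffOn.sum fun j _ =>
      ((hG.smooth _ _).of_le (by simp)).smul contDiffOn_const
  · have hinj : Function.Injective (B x) := by
      rw [injective_iff_map_eq_zero]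
      intro u hu
      by_contra hne
      have := hG.pos x hx u hne
      rw [← hB x hx, hu, inner_zero_left] at this
      exact this.false
    rw [ContinuousLinearMap.isUnit_iff_bijective]
    exact ⟨hinj, (LinearMap.injective_iff_surjective (f := (B x : E3 →ₗ[ℝ] E3))).1 hinj⟩

/-- The acceleration of geodesics as a function of position and velocity. -/
theorem exists_acceleration (hG : IsRiemannianMetricOn S G) (hS : IsOpen S) :
    ∃ A : E3 × E3 → E3, ContDiffOn ℝ 1 A (S ×ˢ univ) ∧
      ∀ x ∈ S, ∀ v w, G x (A (x, v)) w + christoffel G x v v w = 0 := by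
  obtain ⟨B, hB, hu, hBG⟩ := hG.exists_operator
  let e := EuclideanSpace.basisFun (Fin 3) ℝ
  let c : E3 × E3 → E3 := fun q => ∑ k, christoffel G q.1 q.2 q.2 (e k) • e k
  have hc : ContDiffOn ℝ 1 c (S ×ˢ univ) := by
    refine ContDiffOn.sum fun k _ => ?_
    have h := hG.contDiffOn_fderiv hS (e k)
    have h' : ContDiffOn ℝ 1 (fun q : E3 × E3 => christoffel G q.1 q.2 q.2 (e k)) (S ×ˢ univ) :=
      ((h.1.add h.1).sub h.2).div_const 2
    exact h'.smul contDiffOn_const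
  -- The acceleration is -B⁻¹c; it is C¹ because inversion of operators is smooth at units.
  refine ⟨fun q => -(Ring.inverse (B q.1)) (c q), ContDiffOn.neg (ContDiffOn.clm_apply ?_ hc), ?_⟩
  · intro q hq
    obtain ⟨b, hb⟩ := hu q.1 hq.1
    have hinv : ContDiffAt ℝ 1 (Ring.inverse : (E3 →L[ℝ] E3) → _) (B q.1) :=
      hb ▸ contDiffAt_ringInverse ℝ b
    exact hinv.comp_contDiffWithinAt q ((hB.comp contDiff_fst.contDiffOn fun q hq => hq.1) q hq)
  · intro x hx v w
    have hmul : B x (Ring.inverse (B x) (c (x, v))) = c (x, v) := by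
      rw [← mul_apply_eq_comp, Ring.mul_inverse_cancel _ (hu x hx)]
      rfl
    rw [← hBG x hx, map_neg, hmul, hG.christoffel_self_eq_sum hS hx v w]
    simp only [c, inner_neg_left, sum_inner, inner_smul_left]
    rw [neg_add_eq_zero]
    refine Finset.sum_congr rfl fun k _ => ?_
    simp [e, EuclideanSpace.inner_single_left]
    ring

/-- Curves solving the geodesic equation up to a change of speed have constant energy. -/
theorem hasDerivAt_energy (hG : IsRiemannianMetricOn S G) (hS : IsOpen S) {A : E3 × E3 → E3}
    (hA : ∀ x ∈ S, ∀ v w, G x (A (x, v)) w + christoffel G x v v w = 0) {x v : ℝ → E3} {c t : ℝ}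
    (hxS : x t ∈ S) (hx : HasDerivAt x (c • v t) t) (hv : HasDerivAt v (c • A (x t, v t)) t) :
    HasDerivAt (fun s => G (x s) (v s) (v s)) 0 t := by
  have h : (fun s => G (x s) (v s) (v s)) =ᶠ[𝓝 t] fun s => ∑ i, ∑ j, v s i * v s j *
      G (x s) (EuclideanSpace.basisFun _ ℝ i) (EuclideanSpace.basisFun _ ℝ j) := by
    filter_upwards [hx.continuousAt.preimage_mem_nhds (hS.mem_nhds hxS)] with s hs
      using hG.eq_sum hs _ _
  refine HasDerivAt.congr_of_eventuallyEq ?_ h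
  have hvi : ∀ i, HasDerivAt (fun s => v s i) (c * A (x t, v t) i) t := fun i =>
    (EuclideanSpace.proj (𝕜 := ℝ) i).hasFDerivAt.comp_hasDerivAt t hv
  have hg := fun i j => (hG.differentiableAt hS hxS (EuclideanSpace.basisFun _ ℝ i)
    (EuclideanSpace.basisFun _ ℝ j)).hasFDerivAt.comp_hasDerivAt t hx
  have hsum := HasDerivAt.fun_sum fun i (_ : i ∈ Finset.univ) =>
    HasDerivAt.fun_sum fun j (_ : j ∈ Finset.univ) => ((hvi i).mul (hvi j)).mul (hg i j)
  refine hsum.congr_deriv ?_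
  have h0 := hA _ hxS (v t) (v t)
  have h1 : christoffel G (x t) (v t) (v t) (v t) =
      fderiv ℝ (fun y => G y (v t) (v t)) (x t) (v t) / 2 := by
    rw [christoffel]
    ring
  have h2 := hG.symm _ hxS (A (x t, v t)) (v t)
  -- The left side is the derivative of the energy by the product rule; it equals 2c times the
  -- geodesic equation tested against v.
  have h3 : c * (G (x t) (A (x t, v t)) (v t) + G (x t) (v t) (A (x t, v t)) +
      fderiv ℝ (fun y => G y (v t) (v t)) (x t) (v t)) = 0 := by
    rw [← h2]
    linear_combination c * 2 * h0 - 2 * c * h1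
  rw [← h3, hG.fderiv_eq_sum hS hxS, hG.eq_sum hxS (A _), hG.eq_sum hxS (v t)]
  simp only [← Finset.sum_add_distrib, Finset.mul_sum, map_smul, smul_eq_mul]
  refine Finset.sum_congr rfl fun i _ => Finset.sum_congr rfl fun j _ => ?_
  simp only [Pi.mul_apply, Function.comp_apply]
  ring

/-- On a compact set a Riemannian metric dominates a multiple of the Euclidean one. -/
theorem exists_norm_sq_le (hG : IsRiemannianMetricOn S G) {Q : Set E3} (hQ : IsCompact Q)
    (hQS : Q ⊆ S) : ∃ C : ℝ, ∀ x ∈ Q, ∀ v, ‖v‖ ^ 2 ≤ C * G x v v := by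
  have hcont : ContinuousOn (fun q : E3 × E3 => G q.1 q.2 q.2)
      (Q ×ˢ Metric.sphere (0 : E3) 1) := by
    refine ContinuousOn.congr (f := fun q : E3 × E3 => ∑ i, ∑ j, q.2 i * q.2 j *
      G q.1 (EuclideanSpace.basisFun _ ℝ i) (EuclideanSpace.basisFun _ ℝ j)) ?_
      fun q hq => hG.eq_sum (hQS hq.1) _ _
    refine continuousOn_finsetSum _ fun i _ => continuousOn_finsetSum _ fun j _ => ?_
    have hc : ∀ i, Continuous (fun q : E3 × E3 => q.2 i) := fun i => by fun_prop
    exact ((hc i).mul (hc j)).continuousOn.mul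
      ((hG.smooth _ _).continuousOn.comp continuousOn_fst fun q hq => hQS hq.1)
  have hpos : ∀ q ∈ Q ×ˢ Metric.sphere (0 : E3) 1, 0 < G q.1 q.2 q.2 := fun q hq =>
    hG.pos _ (hQS hq.1) _ (Metric.ne_of_mem_sphere hq.2 one_ne_zero)
  -- 1/G is bounded on the compact unit sphere bundle over Q; homogeneity extends the bound to all
  -- vectors.
  obtain ⟨C, hC⟩ := (hQ.prod (isCompact_sphere 0 1)).exists_bound_of_continuousOn
    (hcont.inv₀ fun q hq => (hpos q hq).ne')
  refine ⟨C, fun x hx v => ?_⟩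
  obtain ⟨B, hB⟩ := hG.bilin x (hQS hx)
  rcases eq_or_ne v 0 with rfl | hv
  · rw [← hB]
    simp
  have hn : 0 < ‖v‖ := norm_pos_iff.2 hv
  have hmem : (x, ‖v‖⁻¹ • v) ∈ Q ×ˢ Metric.sphere (0 : E3) 1 :=
    ⟨hx, by simp [norm_smul, hn.ne']⟩
  have h1 := hC _ hmem
  have h2 := hpos _ hmem
  simp only [Real.norm_eq_abs, Pi.inv_apply] at h1
  rw [abs_of_pos (inv_pos.2 h2), inv_le_iff_one_le_mul₀ h2] at h1
  simp only [← hB, map_smul, LinearMap.smul_apply, smul_eq_mul] at h1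
  rw [hB] at h1
  calc ‖v‖ ^ 2 ≤ ‖v‖ ^ 2 * (C * (‖v‖⁻¹ * (‖v‖⁻¹ * G x v v))) :=
        le_mul_of_one_le_right (by positivity) h1
    _ = C * G x v v := by field_simp

/-- **Gordon's completeness criterion**: a Riemannian metric is geodesically complete if there is a
proper function with bounded gradient. -/
theorem geodesicallyComplete (hG : IsRiemannianMetricOn S G) (hS : IsOpen S) {h : E3 → ℝ} {C : ℝ}
    (hd : ∀ x ∈ S, DifferentiableAt ℝ h x)
    (hC : ∀ x ∈ S, ∀ v, fderiv ℝ h x v ^ 2 ≤ C * G x v v)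
    (hproper : ∀ R : ℝ, IsCompact {x | x ∈ S ∧ |h x| ≤ R}) : GeodesicallyComplete S G := by
  intro p hp v₀
  obtain ⟨A, hA, hAG⟩ := hG.exists_acceleration hS
  have hΩ : IsOpen (S ×ˢ (univ : Set E3)) := hS.prod isOpen_univ
  have hF : ContDiffOn ℝ 1 (fun q : E3 × E3 => (q.2, A q)) (S ×ˢ univ) :=
    contDiff_snd.contDiffOn.prodMk hA
  obtain ⟨γ, h0, hγ⟩ := exists_hasDerivAt_of_forall_mem_compact hΩ hF (p := (p, v₀))
    ⟨hp, mem_univ _⟩ (fun T hT => by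
      set e₀ := G p v₀ v₀ with he₀
      -- The radius is what h can reach in time T when its rate of change is at most √(C e₀), with
      -- e₀ the conserved energy.
      have hQS : {x | x ∈ S ∧ |h x| ≤ |h p| + √(C * e₀) * T} ⊆ S := fun x hx => hx.1
      obtain ⟨D, hD⟩ := hG.exists_norm_sq_le (hproper _) hQS
      refine ⟨_, (hproper (|h p| + √(C * e₀) * T)).prod (isCompact_closedBall (0 : E3) √(D * e₀)),
        prod_mono hQS (subset_univ _), fun γ c h0 hc hγ => ?_⟩
      have hx : ∀ t ∈ Ioo (-T) T, HasDerivAt (fun s => (γ s).1) (c t • (γ t).2) t := fun t ht =>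
        (ContinuousLinearMap.fst ℝ E3 E3).hasFDerivAt.comp_hasDerivAt t (hγ t ht).2
      have hv : ∀ t ∈ Ioo (-T) T, HasDerivAt (fun s => (γ s).2) (c t • A (γ t)) t := fun t ht =>
        (ContinuousLinearMap.snd ℝ E3 E3).hasFDerivAt.comp_hasDerivAt t (hγ t ht).2
      have h0T : (0 : ℝ) ∈ Ioo (-T) T := ⟨by linarith, hT⟩
      have hE : ∀ t ∈ Ioo (-T) T, G (γ t).1 (γ t).2 (γ t).2 = e₀ := by
        intro t ht
        have := (convex_Ioo (-T) T).norm_image_sub_le_of_norm_hasDerivWithin_le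
          (f := fun s => G (γ s).1 (γ s).2 (γ s).2) (f' := fun _ => 0) (C := 0)
          (fun s hs => (hG.hasDerivAt_energy hS hAG (x := fun s => (γ s).1)
            (v := fun s => (γ s).2) (hγ s hs).1.1 (hx s hs) (hv s hs)).hasDerivWithinAt)
          (by simp) h0T ht
        simpa [h0, sub_eq_zero] using this
      have hh : ∀ t ∈ Ioo (-T) T, |h (γ t).1| ≤ |h p| + √(C * e₀) * T := by
        intro t ht
        have := (convex_Ioo (-T) T).norm_image_sub_le_of_norm_hasDerivWithin_le
          (f := fun s => h (γ s).1) (C := √(C * e₀))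
          (fun s hs => ((hd _ (hγ s hs).1.1).hasFDerivAt.comp_hasDerivAt s
            (hx s hs)).hasDerivWithinAt)
          (fun s hs => ?_) h0T ht
        · rw [h0, sub_zero, Real.norm_eq_abs, Real.norm_eq_abs] at this
          have h1 : √(C * e₀) * |t| ≤ √(C * e₀) * T :=
            mul_le_mul_of_nonneg_left (abs_lt.2 ht).le (Real.sqrt_nonneg _)
          have h2 := abs_sub_abs_le_abs_sub (h (γ t).1) (h p)
          linarith
        · have hb : |fderiv ℝ h (γ s).1 (γ s).2| ≤ √(C * e₀) :=
            Real.abs_le_sqrt ((hC _ (hγ s hs).1.1 _).trans_eq (by rw [hE s hs]))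
          rw [map_smul, norm_smul, Real.norm_eq_abs, Real.norm_eq_abs, abs_of_nonneg (hc s).1]
          exact (mul_le_of_le_one_left (abs_nonneg _) (hc s).2).trans hb
      intro t ht
      refine ⟨⟨(hγ t ht).1.1, hh t ht⟩, ?_⟩
      rw [mem_closedBall_zero_iff]
      refine Real.le_sqrt_of_sq_le ?_
      rw [← hE t ht]
      exact hD _ ⟨(hγ t ht).1.1, hh t ht⟩ _)
  have hx : ∀ t, HasDerivAt (fun s => (γ s).1) (γ t).2 t := fun t =>
    (ContinuousLinearMap.fst ℝ E3 E3).hasFDerivAt.comp_hasDerivAt t (hγ t).2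
  have hv : ∀ t, HasDerivAt (fun s => (γ s).2) (A (γ t)) t := fun t =>
    (ContinuousLinearMap.snd ℝ E3 E3).hasFDerivAt.comp_hasDerivAt t (hγ t).2
  have hx' : deriv (fun s => (γ s).1) = fun s => (γ s).2 := funext fun t => (hx t).deriv
  have hv' : deriv (fun s => (γ s).2) = fun s => A (γ s) := funext fun t => (hv t).deriv
  have hAc : Continuous fun s => A (γ s) := by
    have hγc : Continuous γ := continuous_iff_continuousAt.2 fun t => (hγ t).2.continuousAt
    exact hA.continuousOn.comp_continuous hγc fun t => (hγ t).1
  refine ⟨fun t => (γ t).1, ⟨?_, fun t => (hγ t).1.1, fun t w => ?_⟩, by simp [h0], ?_⟩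
  · rw [show (2 : WithTop ℕ∞) = 1 + 1 by norm_num, contDiff_succ_iff_deriv, hx']
    refine ⟨fun t => (hx t).differentiableAt, by simp, ?_⟩
    rw [contDiff_one_iff_deriv, hv']
    exact ⟨fun t => (hv t).differentiableAt, hAc⟩
  · rw [hx', hv']
    exact hAG _ (hγ t).1.1 _ _
  · simp [hx', h0]

end IsRiemannianMetricOn

namespace Kerr

variable {M a : ℝ}

/-! ### Inequalities between the coefficients -/

theorem le_r₁ : M ≤ r₁ M a := le_add_of_nonneg_right (Real.sqrt_nonneg _)

theorem r₁_le (hM : 0 < M) : r₁ M a ≤ 2 * M := by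
  have : √(M ^ 2 - a ^ 2) ≤ M := by
    rw [Real.sqrt_le_left hM.le]
    nlinarith [sq_nonneg a]
  unfold r₁
  linarith

theorem sq_le_U (r ϑ : ℝ) : r ^ 2 ≤ U a r ϑ := le_add_of_nonneg_right (by positivity)

theorem U_pos {r : ℝ} (hr : 0 < r) (ϑ : ℝ) : 0 < U a r ϑ := by unfold U; positivity

/-- In this form σ² ≥ U² is visible, and the remainder is the quantity that also governs g̃ - ĝ. -/
theorem sigmaSq_eq (r ϑ : ℝ) : sigmaSq M a r ϑ =
    U a r ϑ ^ 2 + a ^ 2 * Real.sin ϑ ^ 2 * (U a r ϑ + 2 * M * r) := by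
  have h : U a r ϑ = r ^ 2 + a ^ 2 * (1 - Real.sin ϑ ^ 2) := by rw [U, Real.cos_sq']
  rw [sigmaSq, h]
  ring

theorem sigmaSq_pos (hM : 0 < M) {r : ℝ} (hr : 0 < r) (ϑ : ℝ) : 0 < sigmaSq M a r ϑ := by
  have := U_pos (a := a) hr ϑ
  unfold sigmaSq
  positivity

theorem pow_four_le_sigmaSq (hM : 0 < M) {r : ℝ} (hr : 0 < r) (ϑ : ℝ) :
    r ^ 4 ≤ sigmaSq M a r ϑ := by
  have hU := sq_le_U (a := a) r ϑ
  have := U_pos (a := a) hr ϑ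
  calc r ^ 4 = (r ^ 2) ^ 2 := by ring
    _ ≤ U a r ϑ ^ 2 := by gcongr
    _ ≤ sigmaSq M a r ϑ := by
      rw [sigmaSq_eq]
      exact le_add_of_nonneg_right (by positivity)

/-- The roots of Δ are r₁ and 2M - r₁, and the second is nonnegative because r₁ ≤ 2M. -/
theorem Delta_le (hM : 0 < M) (ha : a ^ 2 ≤ M ^ 2) {r : ℝ} (hr : r₁ M a < r) :
    Delta M a r ≤ r * (r - r₁ M a) := by
  have h3 := Real.sq_sqrt (sub_nonneg.2 ha)
  have h : Delta M a r = (r - r₁ M a) * (r - (2 * M - r₁ M a)) := by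
    unfold Delta r₁
    linear_combination h3
  rw [h, mul_comm r]
  exact mul_le_mul_of_nonneg_left (by linarith [r₁_le (a := a) hM]) (by linarith)

/-- Each factor is compared with U ≥ r²: a² sin²ϑ ≤ M² ≤ r² ≤ U, and 2Mr ≤ 2r² ≤ 2U gives the 3. -/
theorem sin_sq_mul_div_le (hM : 0 < M) (ha : a ^ 2 ≤ M ^ 2) {r : ℝ} (hr : r₁ M a < r) (ϑ : ℝ) :
    a ^ 2 * Real.sin ϑ ^ 2 * (U a r ϑ + 2 * M * r) / U a r ϑ ^ 2 ≤ 3 := by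
  have hMr : M < r := le_r₁.trans_lt hr
  have hr0 : 0 < r := hM.trans hMr
  have hU := U_pos (a := a) hr0 ϑ
  have hrU := sq_le_U (a := a) r ϑ
  have h1 : a ^ 2 * Real.sin ϑ ^ 2 ≤ U a r ϑ := by
    have : a ^ 2 * Real.sin ϑ ^ 2 ≤ a ^ 2 * 1 :=
      mul_le_mul_of_nonneg_left (Real.sin_sq_le_one ϑ) (sq_nonneg a)
    have : M ^ 2 ≤ r ^ 2 := by gcongr
    linarith
  have h2 : U a r ϑ + 2 * M * r ≤ 3 * U a r ϑ := by nlinarith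
  rw [div_le_iff₀ (by positivity)]
  calc a ^ 2 * Real.sin ϑ ^ 2 * (U a r ϑ + 2 * M * r) ≤ U a r ϑ * (3 * U a r ϑ) := by
        gcongr
    _ = 3 * U a r ϑ ^ 2 := by ring

theorem sigmaSq_div_U_sq {r : ℝ} (hr : 0 < r) (ϑ : ℝ) : sigmaSq M a r ϑ / U a r ϑ ^ 2 =
    1 + a ^ 2 * Real.sin ϑ ^ 2 * (U a r ϑ + 2 * M * r) / U a r ϑ ^ 2 := by
  have hU := (U_pos (a := a) hr ϑ).ne'
  rw [sigmaSq_eq, add_div, div_self (by positivity)]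

theorem lapse_sq (hM : 0 < M) (ha : a ^ 2 ≤ M ^ 2) {r : ℝ} (hr : r₁ M a < r) (ϑ : ℝ) :
    lapse M a r ϑ ^ 2 = Delta M a r * U a r ϑ / sigmaSq M a r ϑ := by
  have hr0 : 0 < r := hM.trans (le_r₁.trans_lt hr)
  have := Delta_pos ha hr
  have := U_pos (a := a) hr0 ϑ
  have := sigmaSq_pos (a := a) hM hr0 ϑ
  rw [lapse, Real.sq_sqrt (by positivity)]

/-! ### Polar coordinates -/

theorem norm_sq_eq_sum (x : E3) : ‖x‖ ^ 2 = x 0 ^ 2 + x 1 ^ 2 + x 2 ^ 2 := by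
  rw [EuclideanSpace.real_norm_sq_eq, Fin.sum_univ_three]

theorem inner_eq_sum (x y : E3) : inner ℝ x y = x 0 * y 0 + x 1 * y 1 + x 2 * y 2 := by
  rw [PiLp.inner_apply, Fin.sum_univ_three]
  simp [mul_comm]

/-- `Real.arccos` is not smooth at ±1, that is, on the axis; but the coefficients involve ϑ only
through cos²ϑ and sin²ϑ, which are rational in x₂ and ‖x‖. -/
theorem cos_polarAngle (x : E3) : Real.cos (polarAngle x) = x 2 / ‖x‖ := by
  have h : |x 2 / ‖x‖| ≤ 1 := by
    rw [abs_div, abs_norm]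
    refine div_le_one_of_le₀ ?_ (norm_nonneg _)
    refine abs_le_of_sq_le_sq ?_ (norm_nonneg _)
    rw [norm_sq_eq_sum]
    nlinarith [sq_nonneg (x 0), sq_nonneg (x 1)]
  exact Real.cos_arccos (abs_le.1 h).1 (abs_le.1 h).2

theorem sin_sq_polarAngle (x : E3) : Real.sin (polarAngle x) ^ 2 = 1 - (x 2 / ‖x‖) ^ 2 := by
  rw [Real.sin_sq, cos_polarAngle]

theorem norm_pos_of_mem_slice (hM : 0 < M) {x : E3} (hx : x ∈ slice M a) : 0 < ‖x‖ :=
  hM.trans (le_r₁.trans_lt hx)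

theorem isOpen_slice : IsOpen (slice M a) := isOpen_lt continuous_const continuous_norm

theorem roundMetric_self_nonneg (x v : E3) : 0 ≤ roundMetric x v v := by
  refine div_nonneg ?_ (sq_nonneg _)
  have h : |dr x v| ≤ ‖v‖ := by
    rw [dr, abs_div, abs_norm]
    exact div_le_of_le_mul₀ (norm_nonneg _) (norm_nonneg _)
      ((abs_real_inner_le_norm x v).trans_eq (mul_comm _ _))
  rw [real_inner_self_eq_norm_sq, sub_nonneg, ← sq, ← sq_abs]
  gcongr

/-- `(sin² ϑ dφ)² ≤ sin² ϑ (dϑ² + sin² ϑ dφ²)` -/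
theorem axialForm_sq_le {x : E3} (hx : 0 < ‖x‖) (v : E3) :
    axialForm x v * axialForm x v ≤ Real.sin (polarAngle x) ^ 2 * roundMetric x v v := by
  have hn := norm_sq_eq_sum x
  rw [sin_sq_polarAngle, roundMetric, axialForm, dr, ← sub_nonneg]
  -- With L = x × v the round metric is |L|²/‖x‖⁴ and the axial form is L₂/‖x‖². Because L ⊥ x,
  -- Lagrange's identity turns the difference into the single square (L₀x₁ - L₁x₀)²/‖x‖⁶.
  have key : (1 - (x 2 / ‖x‖) ^ 2) * ((inner ℝ v v - inner ℝ x v / ‖x‖ * (inner ℝ x v / ‖x‖)) /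
      ‖x‖ ^ 2) - (x 0 * v 1 - x 1 * v 0) / ‖x‖ ^ 2 * ((x 0 * v 1 - x 1 * v 0) / ‖x‖ ^ 2) =
      ((x 1 * v 2 - x 2 * v 1) * x 1 - (x 2 * v 0 - x 0 * v 2) * x 0) ^ 2 / (‖x‖ ^ 2) ^ 3 := by
    rw [show (x 2 / ‖x‖) ^ 2 = x 2 ^ 2 / ‖x‖ ^ 2 by rw [div_pow],
      show inner ℝ x v / ‖x‖ * (inner ℝ x v / ‖x‖) = inner ℝ x v ^ 2 / ‖x‖ ^ 2 by
        rw [← sq, div_pow], inner_eq_sum v v, inner_eq_sum x v]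
    have h0 : ‖x‖ ^ 2 ≠ 0 := by positivity
    rw [hn] at h0 ⊢
    field_simp
    ring
  rw [key]
  positivity

/-! ### The two metrics on the slice -/

theorem tildeMetric_eq (hM : 0 < M) (ha : a ^ 2 ≤ M ^ 2) {x : E3} (hx : x ∈ slice M a) (v w : E3) :
    tildeMetric M a x v w = hatMetric M a x v w +
      sigmaSq M a ‖x‖ (polarAngle x) / Delta M a ‖x‖ * (a ^ 2 *
        (U a ‖x‖ (polarAngle x) + 2 * M * ‖x‖) / U a ‖x‖ (polarAngle x) ^ 2) *
        (axialForm x v * axialForm x w) := by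
  have hr := norm_pos_of_mem_slice hM hx
  have hD := (Delta_pos ha hx).ne'
  have hU := (U_pos (a := a) hr (polarAngle x)).ne'
  have hs := (sigmaSq_pos (a := a) hM hr (polarAngle x)).ne'
  rw [tildeMetric, lapse_sq hM ha hx, spatialMetric, hatMetric]
  field_simp

theorem hatMetric_le_tildeMetric (hM : 0 < M) (ha : a ^ 2 ≤ M ^ 2) {x : E3} (hx : x ∈ slice M a)
    (v : E3) : hatMetric M a x v v ≤ tildeMetric M a x v v := by
  have hr := norm_pos_of_mem_slice hM hx
  have hD := Delta_pos ha hx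
  have hU := U_pos (a := a) hr (polarAngle x)
  have hs := sigmaSq_pos (a := a) hM hr (polarAngle x)
  rw [tildeMetric_eq hM ha hx]
  exact le_add_of_nonneg_right (mul_nonneg (by positivity) (mul_self_nonneg _))

theorem tildeMetric_le (hM : 0 < M) (ha : a ^ 2 ≤ M ^ 2) {x : E3} (hx : x ∈ slice M a) (v : E3) :
    tildeMetric M a x v v ≤ 4 * hatMetric M a x v v := by
  have hr := norm_pos_of_mem_slice hM hx
  have hD := Delta_pos ha hx
  have hU := U_pos (a := a) hr (polarAngle x)
  have hs := sigmaSq_pos (a := a) hM hr (polarAngle x)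
  have hround := roundMetric_self_nonneg x v
  have h1 : a ^ 2 * (U a ‖x‖ (polarAngle x) + 2 * M * ‖x‖) / U a ‖x‖ (polarAngle x) ^ 2 *
      (axialForm x v * axialForm x v) ≤ 3 * roundMetric x v v := by
    calc _ ≤ a ^ 2 * (U a ‖x‖ (polarAngle x) + 2 * M * ‖x‖) / U a ‖x‖ (polarAngle x) ^ 2 *
          (Real.sin (polarAngle x) ^ 2 * roundMetric x v v) := by
          exact mul_le_mul_of_nonneg_left (axialForm_sq_le hr v) (by positivity)
      _ = a ^ 2 * Real.sin (polarAngle x) ^ 2 * (U a ‖x‖ (polarAngle x) + 2 * M * ‖x‖) /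
          U a ‖x‖ (polarAngle x) ^ 2 * roundMetric x v v := by ring
      _ ≤ 3 * roundMetric x v v := by
          gcongr
          exact sin_sq_mul_div_le hM ha hx _
  have h2 : sigmaSq M a ‖x‖ (polarAngle x) / Delta M a ‖x‖ * roundMetric x v v ≤
      hatMetric M a x v v :=
    le_add_of_nonneg_left (mul_nonneg (by positivity) (mul_self_nonneg _))
  have h3 := mul_le_mul_of_nonneg_left h1
    (show 0 ≤ sigmaSq M a ‖x‖ (polarAngle x) / Delta M a ‖x‖ by positivity)
  rw [tildeMetric_eq hM ha hx, mul_assoc]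
  linarith

theorem hatMetric_pos (hM : 0 < M) (ha : a ^ 2 ≤ M ^ 2) {x : E3} (hx : x ∈ slice M a) {v : E3}
    (hv : v ≠ 0) : 0 < hatMetric M a x v v := by
  have hr := norm_pos_of_mem_slice hM hx
  have hD := Delta_pos ha hx
  have hs := sigmaSq_pos (a := a) hM hr (polarAngle x)
  rw [hatMetric]
  rcases eq_or_ne (dr x v) 0 with h | h
  · have : 0 < roundMetric x v v := by
      have := norm_pos_iff.2 hv
      rw [roundMetric, h, real_inner_self_eq_norm_sq, mul_zero, sub_zero]
      positivity
    rw [h, mul_zero, mul_zero, zero_add]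
    positivity
  · have h1 : 0 < dr x v * dr x v := mul_self_pos.2 h
    have h2 := roundMetric_self_nonneg x v
    positivity

theorem dr_add (x u v : E3) : dr x (u + v) = dr x u + dr x v := by
  rw [dr, inner_add_right, add_div, dr, dr]

theorem dr_smul (x : E3) (c : ℝ) (v : E3) : dr x (c • v) = c * dr x v := by
  rw [dr, inner_smul_right, mul_div_assoc, dr]

theorem axialForm_add (x u v : E3) : axialForm x (u + v) = axialForm x u + axialForm x v := by
  simp only [axialForm, PiLp.add_apply]
  ring

theorem axialForm_smul (x : E3) (c : ℝ) (v : E3) : axialForm x (c • v) = c * axialForm x v := by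
  simp only [axialForm, PiLp.smul_apply, smul_eq_mul]
  ring

/-- Both metrics have this shape, ĝ with δ = 0. -/
theorem exists_bilinForm (x : E3) (α β δ : ℝ) : ∃ B : LinearMap.BilinForm ℝ E3, ∀ u v,
    B u v = α * (dr x u * dr x v) + β * roundMetric x u v + δ * (axialForm x u * axialForm x v) :=
  ⟨LinearMap.mk₂ ℝ (fun u v => α * (dr x u * dr x v) + β * roundMetric x u v +
      δ * (axialForm x u * axialForm x v))
    (fun u u' v => by
      simp only [roundMetric, dr_add, axialForm_add, inner_add_left]
      ring)
    (fun c u v => by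
      simp only [roundMetric, dr_smul, axialForm_smul, real_inner_smul_left, smul_eq_mul]
      ring)
    (fun u v v' => by
      simp only [roundMetric, dr_add, axialForm_add, inner_add_right]
      ring)
    (fun c u v => by
      simp only [roundMetric, dr_smul, axialForm_smul, real_inner_smul_right, smul_eq_mul]
      ring), fun _ _ => rfl⟩

theorem roundMetric_comm (x u v : E3) : roundMetric x u v = roundMetric x v u := by
  rw [roundMetric, real_inner_comm, mul_comm (dr x u), roundMetric]

/-! ### Smoothness of the coefficients and metrics, axis included -/

section Smooth

variable {n : WithTop ℕ∞}

theorem contDiffOn_norm_slice (hM : 0 < M) : ContDiffOn ℝ n (fun x : E3 => ‖x‖) (slice M a) :=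
  contDiffOn_id.norm ℝ fun _ hx => norm_pos_iff.1 (norm_pos_of_mem_slice hM hx)

theorem contDiffOn_cos_slice (hM : 0 < M) :
    ContDiffOn ℝ n (fun x : E3 => x 2 / ‖x‖) (slice M a) :=
  ContDiffOn.div (by fun_prop) (contDiffOn_norm_slice hM)
    fun _ hx => (norm_pos_of_mem_slice hM hx).ne'

theorem contDiffOn_U_slice (hM : 0 < M) :
    ContDiffOn ℝ n (fun x : E3 => U a ‖x‖ (polarAngle x)) (slice M a) := by
  simp only [U, cos_polarAngle]
  exact ((contDiffOn_norm_slice hM).pow 2).add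
    (contDiffOn_const.mul ((contDiffOn_cos_slice hM).pow 2))

theorem contDiffOn_sigmaSq_slice (hM : 0 < M) :
    ContDiffOn ℝ n (fun x : E3 => sigmaSq M a ‖x‖ (polarAngle x)) (slice M a) := by
  simp only [sigmaSq, sin_sq_polarAngle]
  have h := contDiffOn_norm_slice (a := a) (n := n) hM
  exact (((h.pow 2).add contDiffOn_const).mul (contDiffOn_U_slice hM)).add
    (((contDiffOn_const.mul h).mul contDiffOn_const).mul
      (contDiffOn_const.sub ((contDiffOn_cos_slice hM).pow 2)))

theorem contDiffOn_Delta_slice (hM : 0 < M) :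
    ContDiffOn ℝ n (fun x : E3 => Delta M a ‖x‖) (slice M a) := by
  have h := contDiffOn_norm_slice (a := a) (n := n) hM
  exact ((h.pow 2).sub (contDiffOn_const.mul h)).add contDiffOn_const

theorem contDiffOn_dr_slice (hM : 0 < M) (v : E3) :
    ContDiffOn ℝ n (fun x : E3 => dr x v) (slice M a) :=
  ContDiffOn.div (contDiffOn_id.inner ℝ contDiffOn_const) (contDiffOn_norm_slice hM)
    fun _ hx => (norm_pos_of_mem_slice hM hx).ne'

theorem contDiffOn_roundMetric_slice (hM : 0 < M) (v w : E3) :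
    ContDiffOn ℝ n (fun x : E3 => roundMetric x v w) (slice M a) :=
  ContDiffOn.div (contDiffOn_const.sub ((contDiffOn_dr_slice hM v).mul (contDiffOn_dr_slice hM w)))
    ((contDiffOn_norm_slice hM).pow 2) fun _ hx => pow_ne_zero 2 (norm_pos_of_mem_slice hM hx).ne'

theorem contDiffOn_axialForm_slice (hM : 0 < M) (v : E3) :
    ContDiffOn ℝ n (fun x : E3 => axialForm x v) (slice M a) :=
  ContDiffOn.div (by fun_prop) ((contDiffOn_norm_slice hM).pow 2)
    fun _ hx => pow_ne_zero 2 (norm_pos_of_mem_slice hM hx).ne'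

theorem contDiffOn_hatMetric (hM : 0 < M) (ha : a ^ 2 ≤ M ^ 2) (v w : E3) :
    ContDiffOn ℝ n (fun x : E3 => hatMetric M a x v w) (slice M a) :=
  (((contDiffOn_sigmaSq_slice hM).div ((contDiffOn_Delta_slice hM).pow 2)
      fun _ hx => pow_ne_zero 2 (Delta_pos ha hx).ne').mul
    ((contDiffOn_dr_slice hM v).mul (contDiffOn_dr_slice hM w))).add
  (((contDiffOn_sigmaSq_slice hM).div (contDiffOn_Delta_slice hM)
      fun _ hx => (Delta_pos ha hx).ne').mul (contDiffOn_roundMetric_slice hM v w))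

theorem contDiffOn_tildeMetric (hM : 0 < M) (ha : a ^ 2 ≤ M ^ 2) (v w : E3) :
    ContDiffOn ℝ n (fun x : E3 => tildeMetric M a x v w) (slice M a) := by
  refine ContDiffOn.congr ?_ fun x hx => tildeMetric_eq hM ha hx v w
  have hU := contDiffOn_U_slice (a := a) (n := n) hM
  refine (contDiffOn_hatMetric hM ha v w).add ((((contDiffOn_sigmaSq_slice hM).div
    (contDiffOn_Delta_slice hM) fun _ hx => (Delta_pos ha hx).ne').mul ?_).mul
    ((contDiffOn_axialForm_slice hM v).mul (contDiffOn_axialForm_slice hM w)))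
  exact (contDiffOn_const.mul (hU.add (contDiffOn_const.mul (contDiffOn_norm_slice hM)))).div
    (hU.pow 2) fun _ hx => pow_ne_zero 2 (U_pos (norm_pos_of_mem_slice hM hx) _).ne'

end Smooth

theorem isRiemannianMetricOn_hatMetric (hM : 0 < M) (ha : a ^ 2 ≤ M ^ 2) :
    IsRiemannianMetricOn (slice M a) (hatMetric M a) where
  bilin x _ := by
    obtain ⟨B, hB⟩ := exists_bilinForm x (sigmaSq M a ‖x‖ (polarAngle x) / Delta M a ‖x‖ ^ 2)
      (sigmaSq M a ‖x‖ (polarAngle x) / Delta M a ‖x‖) 0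
    exact ⟨B, fun u v => by rw [hB, zero_mul, add_zero, hatMetric]⟩
  symm x _ u v := by rw [hatMetric, mul_comm (dr x u), roundMetric_comm, hatMetric]
  pos _ hx _ hv := hatMetric_pos hM ha hx hv
  smooth := contDiffOn_hatMetric hM ha

theorem isRiemannianMetricOn_tildeMetric (hM : 0 < M) (ha : a ^ 2 ≤ M ^ 2) :
    IsRiemannianMetricOn (slice M a) (tildeMetric M a) where
  bilin x hx := by
    obtain ⟨B, hB⟩ := exists_bilinForm x (sigmaSq M a ‖x‖ (polarAngle x) / Delta M a ‖x‖ ^ 2)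
      (sigmaSq M a ‖x‖ (polarAngle x) / Delta M a ‖x‖) _
    exact ⟨B, fun u v => by rw [hB, tildeMetric_eq hM ha hx, hatMetric]⟩
  symm x _ u v := by
    rw [tildeMetric, spatialMetric, mul_comm (dr x u), roundMetric_comm, mul_comm (axialForm x u),
      tildeMetric, spatialMetric]
  pos _ hx _ hv := (hatMetric_pos hM ha hx hv).trans_le (hatMetric_le_tildeMetric hM ha hx _)
  smooth := contDiffOn_tildeMetric hM ha

/-! ### Completeness -/

theorem hasFDerivAt_log_norm_sub (hM : 0 < M) {x : E3} (hx : x ∈ slice M a) :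
    HasFDerivAt (fun y : E3 => Real.log (‖y‖ - r₁ M a))
      ((‖x‖ - r₁ M a)⁻¹ • ‖x‖⁻¹ • innerSL ℝ x) x := by
  have hr := norm_pos_of_mem_slice hM hx
  have h := ((hasStrictFDerivAt_norm_sq x).hasFDerivAt.sqrt (by positivity)).sub_const (r₁ M a)
  simp only [Real.sqrt_sq (norm_nonneg _)] at h
  refine (h.log (sub_pos.2 hx).ne').congr_fderiv ?_
  ext v
  simp
  field_simp
  exact Or.inl trivial

theorem geodesicallyComplete_tildeMetric (hM : 0 < M) (ha : a ^ 2 ≤ M ^ 2) :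
    GeodesicallyComplete (slice M a) (tildeMetric M a) := by
  refine (isRiemannianMetricOn_tildeMetric hM ha).geodesicallyComplete isOpen_slice
    (C := (M ^ 2)⁻¹) (fun x hx => (hasFDerivAt_log_norm_sub hM hx).differentiableAt)
    (fun x hx v => ?_) fun R => ?_
  · have hr := norm_pos_of_mem_slice hM hx
    have hD := Delta_pos ha hx
    have hs := pow_four_le_sigmaSq (a := a) hM hr (polarAngle x)
    have hs0 := sigmaSq_pos (a := a) hM hr (polarAngle x)
    have hr1 : 0 < ‖x‖ - r₁ M a := sub_pos.2 hx
    have hMr : M < ‖x‖ := le_r₁.trans_lt hx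
    have hval : fderiv ℝ (fun y : E3 => Real.log (‖y‖ - r₁ M a)) x v =
        (‖x‖ - r₁ M a)⁻¹ * dr x v := by
      rw [(hasFDerivAt_log_norm_sub hM hx).fderiv, dr, div_eq_inv_mul]
      rfl
    rw [hval, ← div_eq_inv_mul (tildeMetric M a x v v), le_div_iff₀ (by positivity)]
    refine le_trans ?_ (hatMetric_le_tildeMetric hM ha hx v)
    calc ((‖x‖ - r₁ M a)⁻¹ * dr x v) ^ 2 * M ^ 2
        = M ^ 2 / (‖x‖ - r₁ M a) ^ 2 * (dr x v * dr x v) := by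
          field_simp
      _ ≤ sigmaSq M a ‖x‖ (polarAngle x) / Delta M a ‖x‖ ^ 2 * (dr x v * dr x v) := by
          refine mul_le_mul_of_nonneg_right ?_ (mul_self_nonneg _)
          rw [div_le_div_iff₀ (by positivity) (by positivity)]
          -- This combines M < r, Δ ≤ r(r - r₁) and r⁴ ≤ σ².
          calc M ^ 2 * Delta M a ‖x‖ ^ 2
              ≤ ‖x‖ ^ 2 * (‖x‖ * (‖x‖ - r₁ M a)) ^ 2 := by
                gcongr
                exact Delta_le hM ha hx
            _ = ‖x‖ ^ 4 * (‖x‖ - r₁ M a) ^ 2 := by ring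
            _ ≤ _ := by gcongr
      _ ≤ hatMetric M a x v v := by
          have := roundMetric_self_nonneg x v
          exact le_add_of_nonneg_right (by positivity)
  -- The set |log(r - r₁)| ≤ R is the closed shell exp(-R) ≤ r - r₁ ≤ exp R, which lies strictly
  -- outside the horizon.
  · have h : {x : E3 | x ∈ slice M a ∧ |Real.log (‖x‖ - r₁ M a)| ≤ R} =
        {x | Real.exp (-R) + r₁ M a ≤ ‖x‖} ∩ Metric.closedBall 0 (Real.exp R + r₁ M a) := by
      ext x
      simp only [slice, mem_ofPred_eq, mem_inter_iff, mem_closedBall_zero_iff, ← le_sub_iff_add_le,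
        ← sub_le_iff_le_add, abs_le]
      constructor
      · rintro ⟨hx, h1, h2⟩
        exact ⟨(Real.le_log_iff_exp_le (sub_pos.2 hx)).1 h1,
          (Real.log_le_iff_le_exp (sub_pos.2 hx)).1 h2⟩
      · rintro ⟨h1, h2⟩
        have hx : 0 < ‖x‖ - r₁ M a := (Real.exp_pos _).trans_le h1
        exact ⟨sub_pos.1 hx, (Real.le_log_iff_exp_le hx).2 h1, (Real.log_le_iff_le_exp hx).2 h2⟩
    rw [h]
    exact (isCompact_closedBall _ _).inter_left (isClosed_le continuous_const continuous_norm)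

/-! ### Coordinate expressions -/

theorem fderiv_polarMap (q v : Fin 3 → ℝ) : fderiv ℝ polarMap q v =
    !₂[v 0 * Real.sin (q 1) * Real.cos (q 2) + q 0 * Real.cos (q 1) * Real.cos (q 2) * v 1
        - q 0 * Real.sin (q 1) * Real.sin (q 2) * v 2,
      v 0 * Real.sin (q 1) * Real.sin (q 2) + q 0 * Real.cos (q 1) * Real.sin (q 2) * v 1
        + q 0 * Real.sin (q 1) * Real.cos (q 2) * v 2,
      v 0 * Real.cos (q 1) - q 0 * Real.sin (q 1) * v 1] := by
  have hd : DifferentiableAt ℝ polarMap q := by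
    rw [differentiableAt_euclidean]
    intro i
    fin_cases i <;> simp [polarMap] <;> fun_prop
  have hcomp : ∀ i, (fderiv ℝ polarMap q v) i = fderiv ℝ (fun p => polarMap p i) q v := fun i => by
    have := ((EuclideanSpace.proj (𝕜 := ℝ) i).hasFDerivAt.comp q hd.hasFDerivAt).fderiv
    exact (DFunLike.congr_fun this v).symm
  have hq : ∀ i, HasFDerivAt (fun p : Fin 3 → ℝ => p i) (ContinuousLinearMap.proj i) q := fun i =>
    (ContinuousLinearMap.proj (R := ℝ) (φ := fun _ : Fin 3 => ℝ) i).hasFDerivAt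
  ext i
  rw [hcomp]
  fin_cases i
  · have := ((hq 0).mul (hq 1).sin).mul (hq 2).cos
    refine (DFunLike.congr_fun this.fderiv v).trans ?_
    simp
    ring
  · have := ((hq 0).mul (hq 1).sin).mul (hq 2).sin
    refine (DFunLike.congr_fun this.fderiv v).trans ?_
    simp
    ring
  · have := (hq 0).mul (hq 1).cos
    refine (DFunLike.congr_fun this.fderiv v).trans ?_
    simp
    ring

theorem norm_polarMap {q : Fin 3 → ℝ} (hq : 0 ≤ q 0) : ‖polarMap q‖ = q 0 := by
  rw [← sq_eq_sq₀ (norm_nonneg _) hq, norm_sq_eq_sum]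
  simp [polarMap]
  linear_combination (q 0) ^ 2 * Real.sin (q 1) ^ 2 * Real.sin_sq_add_cos_sq (q 2) +
    (q 0) ^ 2 * Real.sin_sq_add_cos_sq (q 1)

theorem polarAngle_polarMap {q : Fin 3 → ℝ} (hq : 0 < q 0) (hq1 : q 1 ∈ Icc 0 Real.pi) :
    polarAngle (polarMap q) = q 1 := by
  rw [polarAngle, norm_polarMap hq.le]
  simp [polarMap, hq.ne', Real.arccos_cos hq1.1 hq1.2]

theorem dr_polarMap {q : Fin 3 → ℝ} (hq : 0 < q 0) (v : Fin 3 → ℝ) :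
    dr (polarMap q) (fderiv ℝ polarMap q v) = v 0 := by
  rw [dr, norm_polarMap hq.le, inner_eq_sum, fderiv_polarMap, div_eq_iff hq.ne']
  simp [polarMap]
  linear_combination (q 0 * Real.sin (q 1) ^ 2 * v 0 +
      q 0 ^ 2 * Real.sin (q 1) * Real.cos (q 1) * v 1) * Real.sin_sq_add_cos_sq (q 2) +
    q 0 * v 0 * Real.sin_sq_add_cos_sq (q 1)

theorem axialForm_polarMap {q : Fin 3 → ℝ} (hq : 0 < q 0) (v : Fin 3 → ℝ) :
    axialForm (polarMap q) (fderiv ℝ polarMap q v) = Real.sin (q 1) ^ 2 * v 2 := by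
  rw [axialForm, norm_polarMap hq.le, fderiv_polarMap, div_eq_iff (by positivity)]
  simp [polarMap]
  linear_combination (q 0) ^ 2 * Real.sin (q 1) ^ 2 * v 2 * Real.sin_sq_add_cos_sq (q 2)

theorem roundMetric_polarMap {q : Fin 3 → ℝ} (hq : 0 < q 0) (v w : Fin 3 → ℝ) :
    roundMetric (polarMap q) (fderiv ℝ polarMap q v) (fderiv ℝ polarMap q w) =
      v 1 * w 1 + Real.sin (q 1) ^ 2 * (v 2 * w 2) := by
  rw [roundMetric, dr_polarMap hq, dr_polarMap hq, norm_polarMap hq.le, inner_eq_sum,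
    fderiv_polarMap, fderiv_polarMap, div_eq_iff (by positivity)]
  simp
  linear_combination ((v 0 * Real.sin (q 1) + q 0 * Real.cos (q 1) * v 1) *
      (w 0 * Real.sin (q 1) + q 0 * Real.cos (q 1) * w 1) +
      q 0 ^ 2 * Real.sin (q 1) ^ 2 * v 2 * w 2) * Real.sin_sq_add_cos_sq (q 2) +
    (v 0 * w 0 + q 0 ^ 2 * v 1 * w 1) * Real.sin_sq_add_cos_sq (q 1)

theorem hasBLForm_hatMetric (hM : 0 < M) :
    HasBLForm M a (hatMetric M a) (hatMetricBL M a) := by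
  intro q hq hq1 v w
  have hq0 : 0 < q 0 := hM.trans (le_r₁.trans_lt hq)
  rw [hatMetric, norm_polarMap hq0.le, polarAngle_polarMap hq0 hq1, dr_polarMap hq0,
    dr_polarMap hq0, roundMetric_polarMap hq0, hatMetricBL]

theorem hasBLForm_tildeMetric (hM : 0 < M) :
    HasBLForm M a (tildeMetric M a) (tildeMetricBL M a) := by
  intro q hq hq1 v w
  have hq0 : 0 < q 0 := hM.trans (le_r₁.trans_lt hq)
  have hU := (U_pos (a := a) hq0 (q 1)).ne'
  have hc : U a (q 0) (q 1) = q 0 ^ 2 + a ^ 2 * (1 - Real.sin (q 1) ^ 2) := by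
    rw [U, Real.cos_sq']
  rw [tildeMetric, spatialMetric, norm_polarMap hq0.le, polarAngle_polarMap hq0 hq1,
    dr_polarMap hq0, dr_polarMap hq0, roundMetric_polarMap hq0, axialForm_polarMap hq0,
    axialForm_polarMap hq0, tildeMetricBL, spatialMetricBL]
  congr 1
  simp only [spacetimeMetric, Matrix.cons_val]
  -- Once the lapse factor is removed, the dr² and dϑ² terms agree literally; only the dφ²
  -- coefficients need an identity.
  have key : U a (q 0) (q 1) * Real.sin (q 1) ^ 2 +
      a ^ 2 * (1 + 2 * M * q 0 / U a (q 0) (q 1)) * Real.sin (q 1) ^ 4 =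
      -(Delta M a (q 0) / U a (q 0) (q 1)) * (a ^ 2 * Real.sin (q 1) ^ 4) +
        Real.sin (q 1) ^ 2 / U a (q 0) (q 1) * (q 0 ^ 2 + a ^ 2) ^ 2 := by
    field_simp
    rw [hc, Delta]
    ring
  linear_combination (v 2 * w 2) * key

end Kerr
theorem mainTheorem9 (M a : ℝ) (hM : 0 < M) (ha : a ^ 2 ≤ M ^ 2) :
    -- `g̃ = N⁻² g` is a Riemannian metric on the slice with the expected coordinate expression
    IsRiemannianMetricOn (Kerr.slice M a) (Kerr.tildeMetric M a) ∧
    Kerr.HasBLForm M a (Kerr.tildeMetric M a) (Kerr.tildeMetricBL M a) ∧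
    -- it is geodesically complete
    GeodesicallyComplete (Kerr.slice M a) (Kerr.tildeMetric M a) ∧
    -- it is uniformly equivalent to `ĝ`, with `1 ≤ σ²/U² ≤ f`
    IsRiemannianMetricOn (Kerr.slice M a) (Kerr.hatMetric M a) ∧
    Kerr.HasBLForm M a (Kerr.hatMetric M a) (Kerr.hatMetricBL M a) ∧
    ∃ f : ℝ, 1 ≤ f ∧
      (∀ r ϑ : ℝ, Kerr.r₁ M a < r →
        1 ≤ Kerr.sigmaSq M a r ϑ / Kerr.U a r ϑ ^ 2 ∧
          Kerr.sigmaSq M a r ϑ / Kerr.U a r ϑ ^ 2 ≤ f) ∧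
      ∀ x ∈ Kerr.slice M a, ∀ v : E3,
        Kerr.hatMetric M a x v v ≤ Kerr.tildeMetric M a x v v ∧
          Kerr.tildeMetric M a x v v ≤ f * Kerr.hatMetric M a x v v := by
  -- The witness f = 4 is 1 + 3, with the 3 of `Kerr.sin_sq_mul_div_le`.
  refine ⟨Kerr.isRiemannianMetricOn_tildeMetric hM ha, Kerr.hasBLForm_tildeMetric hM,
    Kerr.geodesicallyComplete_tildeMetric hM ha, Kerr.isRiemannianMetricOn_hatMetric hM ha,
    Kerr.hasBLForm_hatMetric hM, 4, by norm_num, fun r ϑ hr => ?_, fun x hx v =>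
    ⟨Kerr.hatMetric_le_tildeMetric hM ha hx v, Kerr.tildeMetric_le hM ha hx v⟩⟩
  have hr0 : 0 < r := hM.trans (Kerr.le_r₁.trans_lt hr)
  have hU := Kerr.U_pos (a := a) hr0 ϑ
  rw [Kerr.sigmaSq_div_U_sq hr0]
  refine ⟨le_add_of_nonneg_right (by positivity), ?_⟩
  linarith [Kerr.sin_sq_mul_div_le hM ha hr ϑ]
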